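/- Let $\mathcal X,\mathcal A$ be finite sets, $N,T\ge 1$, let $p=(p_n)_{1\le n\le N}$ be transition kernels, $p_n(\cdot\mid x,a)\in\Delta_{\mathcal X}$, and let $\rho\in\Delta_{\mathcal X\times\mathcal A}$. For a policy $\pi=(\pi_n)_{1\le n\le N}$, $\pi_n(\cdot\mid x)\in\Delta_{\mathcal A}$, and a family of kernels $q=(q_n)_{1\le n\le N}$, let $Q_\pi=Q^\pi_1Q^\pi_2\cdots Q^\pi_N$ be the matrix on $\mathcal X\times\mathcal A$ with $Q^\pi_n(y,(x,a))=q_n(x\mid y)\,\pi_n(a\mid x)$; write $P_\pi$ for it when $q=p$. Assume that for some $0\le\alpha<1$, $$\|\nu P_\pi-\nu'P_\pi\|_1\le\alpha\|\nu-\nu'\|_1\quad\text{for all policies }\pi\text{ and all }\nu,\nu'\in\Delta_{\mathcal X\times\mathcal A}.$$ Agents interact with this Markov decision process during $T$ episodes of length $N$. Let $\mathcal G_t$ be the information available at the beginning of episode $t$ (the past trajectories of the restarted agent and possibly those of other agents, past losses, and internal randomness of the learner). The policy $\pi_t$ played in episode $t$ is any $\mathcal G_t$-measurable random policy; in particular the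 policies may be those computed by a mirror descent algorithm from the past data. The true initial distributions are $\rho_1=\rho$, $\rho_{t+1}=\rho_tP_{\pi_t}$. Their estimates are $\tilde\rho_1=\rho$ and $\tilde\rho_{t+1}=\tilde\rho_t\widetilde P^t_{\pi_t}$, where $\widetilde P^t_{\pi}$ is the matrix $Q_\pi$ of the empirical kernel $q=\tilde p_t$ defined as follows. In each episode $t$ one agent is reset: conditionally on $\mathcal G_t$, its trajectory $(\tilde x_{t,n},\tilde a_{t,n})_{0\le n\le N}$ starts from a pair drawn from $\tilde\rho_t$ and follows $\pi_t$ in the true dynamics $p$, and the trajectory is $\mathcal G_{t+1}$-measurable. With $$\widetilde N_{t,n}(x,a)=\sum_{s=1}^{t-1}\mathbf 1_{\{\tilde x_{s,n}=x,\ \tilde a_{s,n}=a\}},\qquad \widetilde M_{t,n}(x'\mid x,a)=\sum_{s=1}^{t-1}\mathbf 1_{\{\tilde x_{s,n+1}=x',\ \tilde x_{s,n}=x,\ \tilde a_{s,n}=a\}}$$ for $0\le n\le N-1$, put $\tilde p_{t,n+1}(x'\mid x,a)=\widetilde M_{t,n}(x'\mid x,a)/\max\{1,\widetilde N_{t,n}(x,a)\}$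 if $\widetilde N_{t,n}(x,a)\ge1$, and $\tilde p_{t,n+1}(x'\mid x,a)=1/|\mathcal X|$ otherwise. Then for every $\delta\in(0,1)$, with probability at least $1-2\delta$, $$\sum_{t=1}^T\|\rho_t-\tilde\rho_t\|_1\le\frac1{1-\alpha}\left[3N|\mathcal X|\sqrt{2|\mathcal A|T\log\frac{|\mathcal X||\mathcal A|NT}{\delta}}+2N|\mathcal X|\sqrt{2T\log\frac N\delta}\right].$$ -/

import Mathlib

open MeasureTheory

namespace PeriodicMDP

variable {X A : Type*} [Fintype X] [Fintype A] [DecidableEq X] [DecidableEq A] {N : ℕ}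

/-- The `L₁` norm of a real vector indexed by a finite type. -/
def l1norm {ι : Type*} [Fintype ι] (v : ι → ℝ) : ℝ := ∑ i, |v i|

/-- `p` is a time-dependent transition kernel over a horizon of `N` steps: `p n (x, a) x'` is the
probability to move from the pair `(x, a)` at time `n` to the state `x'` at time `n + 1`
(so `p n` is the kernel with subscript `n + 1` in one-based notation). -/
def IsKernel (p : Fin N → X × A → X → ℝ) : Prop := ∀ n y, p n y ∈ stdSimplex ℝ X

/-- `π` is a non-stationary randomised Markov policy: `π n x a` is the probability of
playing `a` in the state `x` reached at time `n + 1`. -/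
def IsPolicy (π : Fin N → X → A → ℝ) : Prop := ∀ n x, π n x ∈ stdSimplex ℝ A

/-- One-step transition matrix on state-action pairs, from time `n` to time `n + 1`:
`(y, (x, a)) ↦ p_{n+1}(x | y) π_{n+1}(a | x)`. -/
def stepMatrix (p : Fin N → X × A → X → ℝ) (π : Fin N → X → A → ℝ) (n : Fin N) :
    Matrix (X × A) (X × A) ℝ :=
  Matrix.of fun y y' => p n y y'.1 * π n y'.1 y'.2

/-- The matrix `P_π` of a whole episode, the ordered product of the `N` one-step matrices. -/
def episodeMatrix (p : Fin N → X × A → X → ℝ) (π : Fin N → X → A → ℝ) :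
    Matrix (X × A) (X × A) ℝ :=
  (List.ofFn fun n => stepMatrix p π n).prod

/-- All-policy contraction: for every policy `π` the map `ν ↦ ν P_π` contracts the `L₁` distance
of probability distributions by the factor `α`. -/
def AllPolicyContraction (p : Fin N → X × A → X → ℝ) (α : ℝ) : Prop :=
  ∀ π : Fin N → X → A → ℝ, IsPolicy π →
    ∀ ν ∈ stdSimplex ℝ (X × A), ∀ ν' ∈ stdSimplex ℝ (X × A),
      l1norm (Matrix.vecMul ν (episodeMatrix p π) - Matrix.vecMul ν' (episodeMatrix p π))
        ≤ α * l1norm (ν - ν')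

/-- The number of episodes `s < t` in which the trajectory is at the pair `y` at time `n`.
Here `τ s` is the trajectory `(y_{s,0}, …, y_{s,N})` of episode `s`; episodes are numbered
`0, 1, …, T - 1`. -/
def visitCount (τ : ℕ → Fin (N + 1) → X × A) (t : ℕ) (n : Fin N) (y : X × A) : ℕ :=
  ((Finset.range t).filter fun s => τ s n.castSucc = y).card

/-- The number of episodes `s < t` in which the trajectory moves from the pair `y` at time `n`
to the state `x'` at time `n + 1`. -/
def transitionCount (τ : ℕ → Fin (N + 1) → X × A) (t : ℕ) (n : Fin N) (y : X × A) (x' : X) : ℕ :=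
  ((Finset.range t).filter fun s => τ s n.castSucc = y ∧ (τ s n.succ).1 = x').card

/-- The empirical kernel at the beginning of episode `t`, computed from the episodes `s < t`.
The row of a pair that has not been visited yet keeps its initial value, the uniform
distribution. -/
noncomputable def empiricalKernel (τ : ℕ → Fin (N + 1) → X × A) (t : ℕ) :
    Fin N → X × A → X → ℝ :=
  fun n y x' =>
    if visitCount τ t n y = 0 then 1 / (Fintype.card X : ℝ)
    else (transitionCount τ t n y x' : ℝ) / max 1 (visitCount τ t n y : ℝ)

/-- The true initial distributions `ρ_t` without resets: `ρ_0 = ρ`, `ρ_{t+1} = ρ_t P_{π_t}`. -/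
def trueInit (p : Fin N → X × A → X → ℝ) (ρ : X × A → ℝ) (π : ℕ → Fin N → X → A → ℝ) :
    ℕ → X × A → ℝ
  | 0 => ρ
  | t + 1 => Matrix.vecMul (trueInit p ρ π t) (episodeMatrix p (π t))

/-- The estimated initial distributions: the first one is `ρ`, and the one of episode `t + 1` is
the one of episode `t` times the episode matrix of `π_t` under the empirical kernel of
episode `t`. -/
noncomputable def estInit (ρ : X × A → ℝ) (π : ℕ → Fin N → X → A → ℝ)
    (τ : ℕ → Fin (N + 1) → X × A) : ℕ → X × A → ℝ
  | 0 => ρ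
  | t + 1 => Matrix.vecMul (estInit ρ π τ t) (episodeMatrix (empiricalKernel τ t) (π t))

/-- The interaction protocol over `T` episodes. The σ-algebra `𝓖 t` is the information available
at the beginning of episode `t` (past trajectories of the restarted agent and of all other agents,
past losses, internal randomness of the learner). The policy `π t` played in episode `t` is chosen
from this information; the restarted agent is then reset to a pair drawn from the estimated
distribution of episode `t` and follows `π t` in the true dynamics `p`, and its trajectory
`τ t = (y_{t,0}, …, y_{t,N})` belongs to the information available at the next episode. -/
structure IsRestartProtocol {Ω : Type*} {mΩ : MeasurableSpace Ω} (ℙ : Measure Ω)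
    (𝓖 : Filtration ℕ mΩ) (T : ℕ) (p : Fin N → X × A → X → ℝ) (ρ : X × A → ℝ)
    (π : ℕ → Ω → Fin N → X → A → ℝ) (τ : ℕ → Ω → Fin (N + 1) → X × A) : Prop where
  isPolicy : ∀ t < T, ∀ ω, IsPolicy (π t ω)
  measurable_policy : ∀ t < T, ∀ n x a, Measurable[𝓖 t] fun ω => π t ω n x a
  measurable_trajectory : ∀ t < T, ∀ y, MeasurableSet[𝓖 (t + 1)] {ω | τ t ω = y}
  law_trajectory : ∀ t < T, ∀ y : Fin (N + 1) → X × A,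
    ℙ[Set.indicator {ω | τ t ω = y} (fun _ => (1 : ℝ)) | 𝓖 t] =ᵐ[ℙ] fun ω =>
      estInit ρ (fun s => π s ω) (fun s => τ s ω) t (y 0) *
        ∏ n : Fin N, stepMatrix p (π t ω) n (y n.castSucc) (y n.succ)

end PeriodicMDP

/-! Let `d t` be the `L₁` error of the estimated initial distribution. Inserting the estimate pushed
through the true episode matrix gives `d (t+1) ≤ α * d t + e t`, where `e t` is the cost of
replacing the true kernel by the empirical one during one episode started from the estimate. As `d 0
= 0`, summation gives the factor `(1 - α)⁻¹` (`sum_le_of_contraction`). By the simulation inequality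
(`l1norm_vecMul_prod_sub_le`), `e t` is at most the mean of the row errors of the empirical kernel
along a path that starts from the estimate and follows the true dynamics. This is exactly the
conditional law of the restarted trajectory, so Azuma–Hoeffding replaces the mean by the errors at
the pairs actually visited, at cost `√(2T log(N/δ))` per step. At visited pairs the error is at most
a confidence width `c / √(visits)`, and 2 at a first visit. Pigeonhole and Cauchy–Schwarz
(`sum_width_le`, `sum_sqrt_visitCount_le`) sum these to order `√T`. The width comes from Hoeffding
bounds for the empirical mass of each set of states. Policies are adaptive, so visits are not
independent samples; an exponential supermartingale frozen after `m` visits takes the place of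
independence (`IsRestartProtocol.measureReal_empirical_ge_le`). A union bound over step, pair,
number of visits and set of states finishes the proof. -/

namespace PeriodicMDP

/-! ### The `L₁` norm and probability vectors -/

section L1

variable {ι : Type*} [Fintype ι]

lemma l1norm_nonneg (v : ι → ℝ) : 0 ≤ l1norm v := Finset.sum_nonneg fun _ _ => abs_nonneg _

lemma l1norm_add_le (v w : ι → ℝ) : l1norm (v + w) ≤ l1norm v + l1norm w := by
  unfold l1norm
  rw [← Finset.sum_add_distrib]
  exact Finset.sum_le_sum fun i _ => abs_add_le _ _

lemma l1norm_sub_le_two {v w : ι → ℝ} (hv : v ∈ stdSimplex ℝ ι) (hw : w ∈ stdSimplex ℝ ι) :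
    l1norm (v - w) ≤ 2 := by
  have h : l1norm (v - w) ≤ ∑ i, (v i + w i) := Finset.sum_le_sum fun i _ => by
    have h1 := hv.1 i
    have h2 := hw.1 i
    rw [Pi.sub_apply, abs_le]
    constructor <;> linarith
  rw [Finset.sum_add_distrib, hv.2, hw.2] at h
  linarith

/-- The `L₁` distance of two probability vectors is twice the largest difference of the
probabilities of a set. -/
lemma exists_l1norm_sub_eq {v w : ι → ℝ} (hv : v ∈ stdSimplex ℝ ι) (hw : w ∈ stdSimplex ℝ ι) :
    ∃ S : Finset ι, l1norm (v - w) = 2 * ((∑ i ∈ S, v i) - ∑ i ∈ S, w i) := by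
  classical
  refine ⟨Finset.univ.filter fun i => w i ≤ v i, ?_⟩
  have h0 : ∑ i, (v i - w i) = 0 := by rw [Finset.sum_sub_distrib, hv.2, hw.2, sub_self]
  rw [← Finset.sum_sub_distrib, Finset.sum_filter]
  -- This is `|r| = 2 r⁺ - r`; the last terms cancel in the sum because both vectors have mass one.
  have h1 : l1norm (v - w) = ∑ i, (2 * (if w i ≤ v i then v i - w i else 0) - (v i - w i)) := by
    refine Finset.sum_congr rfl fun i _ => ?_
    rw [Pi.sub_apply]
    split_ifs with h
    · rw [abs_of_nonneg (by linarith)]; ring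
    · rw [abs_of_neg (by linarith)]; ring
  rw [h1, Finset.sum_sub_distrib, h0, ← Finset.mul_sum, sub_zero]

end L1

/-! ### Path weights and the simulation inequality -/

section Stochastic

variable {Y : Type*} [Fintype Y]

lemma vecMul_mem_stdSimplex {ν : Y → ℝ} {M : Matrix Y Y ℝ} (hν : ν ∈ stdSimplex ℝ Y)
    (hM : ∀ a, M a ∈ stdSimplex ℝ Y) : Matrix.vecMul ν M ∈ stdSimplex ℝ Y := by
  refine ⟨fun b => Finset.sum_nonneg fun a _ => mul_nonneg (hν.1 a) ((hM a).1 b), ?_⟩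
  simp only [Matrix.vecMul, dotProduct]
  rw [Finset.sum_comm]
  simp_rw [← Finset.mul_sum, (hM _).2, mul_one]
  exact hν.2

lemma l1norm_vecMul_le (v : Y → ℝ) (M : Matrix Y Y ℝ) :
    l1norm (Matrix.vecMul v M) ≤ ∑ a, |v a| * l1norm (M a) := by
  simp only [l1norm, Matrix.vecMul, dotProduct]
  simp_rw [Finset.mul_sum]
  rw [Finset.sum_comm]
  refine Finset.sum_le_sum fun b _ => (Finset.abs_sum_le_sum_abs _ _).trans ?_
  exact Finset.sum_le_sum fun a _ => (abs_mul _ _).le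

lemma l1norm_eq_one {v : Y → ℝ} (hv : v ∈ stdSimplex ℝ Y) : l1norm v = 1 := by
  rw [← hv.2]
  exact Finset.sum_congr rfl fun i _ => abs_of_nonneg (hv.1 i)

lemma l1norm_vecMul_le_of_stochastic (v : Y → ℝ) {M : Matrix Y Y ℝ}
    (hM : ∀ a, M a ∈ stdSimplex ℝ Y) : l1norm (Matrix.vecMul v M) ≤ l1norm v := by
  refine (l1norm_vecMul_le v M).trans (le_of_eq ?_)
  exact Finset.sum_congr rfl fun a _ => by rw [l1norm_eq_one (hM a), mul_one]

lemma prod_ofFn_mem_stdSimplex [DecidableEq Y] {N : ℕ} {K : Fin N → Matrix Y Y ℝ}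
    (hK : ∀ n a, K n a ∈ stdSimplex ℝ Y) (a : Y) : (List.ofFn K).prod a ∈ stdSimplex ℝ Y := by
  induction N generalizing a with
  | zero =>
    rw [List.ofFn_zero, List.prod_nil]
    refine ⟨fun b => ?_, ?_⟩
    · rw [Matrix.one_apply]; split_ifs <;> norm_num
    · simp [Matrix.one_apply]
  | succ N ih =>
    rw [List.ofFn_succ, List.prod_cons, Matrix.mul_apply_eq_vecMul]
    exact vecMul_mem_stdSimplex (hK 0 a) fun b => ih (fun n => hK n.succ) b

/-- The weight of a path for the Markov chain with initial vector `ν` and transition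
matrices `K`. -/
def pathWeight {N : ℕ} (ν : Y → ℝ) (K : Fin N → Matrix Y Y ℝ) (y : Fin (N + 1) → Y) : ℝ :=
  ν (y 0) * ∏ n, K n (y n.castSucc) (y n.succ)

omit [Fintype Y] in
lemma pathWeight_nonneg {N : ℕ} {ν : Y → ℝ} {K : Fin N → Matrix Y Y ℝ} (hν : ∀ a, 0 ≤ ν a)
    (hK : ∀ n a b, 0 ≤ K n a b) (y : Fin (N + 1) → Y) : 0 ≤ pathWeight ν K y :=
  mul_nonneg (hν _) (Finset.prod_nonneg fun n _ => hK n _ _)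

omit [Fintype Y] in
-- The first transition is absorbed into the initial vector, which is then no longer a probability
-- vector; hence path weights are defined for arbitrary `ν`.
lemma pathWeight_cons {N : ℕ} (ν : Y → ℝ) (K : Fin (N + 1) → Matrix Y Y ℝ) (a : Y)
    (y : Fin (N + 1) → Y) :
    pathWeight ν K (Fin.cons a y : Fin (N + 2) → Y) =
      pathWeight (fun b => ν a * K 0 a b) (fun n => K n.succ) y := by
  simp [pathWeight, Fin.prod_univ_succ, mul_assoc, Fin.castSucc_succ]

lemma sum_path_succ {N : ℕ} (f : (Fin (N + 2) → Y) → ℝ) :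
    ∑ y, f y = ∑ a, ∑ y : Fin (N + 1) → Y, f (Fin.cons a y) := by
  rw [← (Fin.consEquiv fun _ : Fin (N + 2) => Y).sum_comp, Fintype.sum_prod_type]
  rfl

/-- Markov property at time 1: summing out the starting point pushes `ν` forward by `K 0`. The
inductions on the horizon below rest on it. -/
lemma sum_pathWeight_tail {N : ℕ} (ν : Y → ℝ) (K : Fin (N + 1) → Matrix Y Y ℝ)
    (φ : (Fin (N + 1) → Y) → ℝ) :
    ∑ y : Fin (N + 2) → Y, pathWeight ν K y * φ (fun n => y n.succ) =
      ∑ y, pathWeight (Matrix.vecMul ν (K 0)) (fun n => K n.succ) y * φ y := by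
  rw [sum_path_succ, Finset.sum_comm]
  refine Finset.sum_congr rfl fun y _ => ?_
  simp_rw [pathWeight_cons]
  simp only [Fin.cons_succ, pathWeight, Matrix.vecMul, dotProduct, Finset.sum_mul]

lemma sum_pathWeight {N : ℕ} (ν : Y → ℝ) {K : Fin N → Matrix Y Y ℝ}
    (hK : ∀ n a, K n a ∈ stdSimplex ℝ Y) : ∑ y, pathWeight ν K y = ∑ a, ν a := by
  induction N generalizing ν with
  | zero =>
    rw [← (Equiv.funUnique (Fin 1) Y).symm.sum_comp]
    simp [pathWeight]
  | succ N ih =>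
    have h := sum_pathWeight_tail ν K (fun _ => 1)
    simp only [mul_one] at h
    rw [h, ih _ fun n => hK n.succ]
    simp only [Matrix.vecMul, dotProduct]
    rw [Finset.sum_comm]
    simp_rw [← Finset.mul_sum, (hK 0 _).2, mul_one]

/-- The value of `φ` joins the first transition in the initial vector of the remaining path, whose
total mass `sum_pathWeight` computes. -/
lemma sum_pathWeight_pair_zero {N : ℕ} (ν : Y → ℝ) {K : Fin (N + 1) → Matrix Y Y ℝ}
    (hK : ∀ n a, K n a ∈ stdSimplex ℝ Y) (φ : Y → Y → ℝ) :
    ∑ y, pathWeight ν K y * φ (y 0) (y 1) = ∑ a, ν a * ∑ b, K 0 a b * φ a b := by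
  rw [sum_path_succ]
  refine Finset.sum_congr rfl fun a _ => ?_
  have h : ∀ y : Fin (N + 1) → Y,
      pathWeight ν K (Fin.cons a y : Fin (N + 2) → Y) *
        φ ((Fin.cons a y : Fin (N + 2) → Y) 0) ((Fin.cons a y : Fin (N + 2) → Y) 1) =
      pathWeight (fun b => ν a * (K 0 a b * φ a b)) (fun n => K n.succ) y := fun y => by
    have h1 : (Fin.cons a y : Fin (N + 2) → Y) 1 = y 0 := rfl
    rw [pathWeight_cons, h1, Fin.cons_zero, pathWeight, pathWeight]
    ring
  simp_rw [h]
  rw [sum_pathWeight _ fun n => hK n.succ, Finset.mul_sum]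

/-- Pushing `ν` forward moves step `m` to step 0. With `φ` an exponential, this turns a one-step
moment bound into the supermartingale condition for a whole trajectory. -/
lemma sum_pathWeight_pair_le {N : ℕ} {ν : Y → ℝ} {K : Fin N → Matrix Y Y ℝ}
    (hν : ν ∈ stdSimplex ℝ Y) (hK : ∀ n a, K n a ∈ stdSimplex ℝ Y) (m : Fin N) (φ : Y → Y → ℝ)
    (hφ : ∀ a, ∑ b, K m a b * φ a b ≤ 1) :
    ∑ y, pathWeight ν K y * φ (y m.castSucc) (y m.succ) ≤ 1 := by
  induction N generalizing ν with
  | zero => exact m.elim0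
  | succ N ih =>
    induction m using Fin.cases with
    | zero =>
      refine (sum_pathWeight_pair_zero ν hK φ).trans_le ?_
      rw [← hν.2]
      exact Finset.sum_le_sum fun a _ => mul_le_of_le_one_right (hν.1 a) (hφ a)
    | succ m =>
      refine (sum_pathWeight_tail ν K fun y => φ (y m.castSucc) (y m.succ)).trans_le ?_
      exact ih (vecMul_mem_stdSimplex hν (hK 0)) (fun n => hK n.succ) m hφ

/-- Simulation inequality: the distributions after a whole episode under two families of
transition matrices differ by at most the expected sum of the one-step differences along the
path followed under the first family. -/
lemma l1norm_vecMul_prod_sub_le [DecidableEq Y] {N : ℕ} {ν : Y → ℝ} {K K' : Fin N → Matrix Y Y ℝ}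
    (hν : ∀ a, 0 ≤ ν a) (hK : ∀ n a, K n a ∈ stdSimplex ℝ Y)
    (hK' : ∀ n a, K' n a ∈ stdSimplex ℝ Y) :
    l1norm (Matrix.vecMul ν (List.ofFn K).prod - Matrix.vecMul ν (List.ofFn K').prod) ≤
      ∑ m, ∑ y, pathWeight ν K y * l1norm (K m (y m.castSucc) - K' m (y m.castSucc)) := by
  induction N generalizing ν with
  | zero => simp [l1norm]
  | succ N ih =>
    rw [List.ofFn_succ, List.ofFn_succ, List.prod_cons, List.prod_cons, ← Matrix.vecMul_vecMul,
      ← Matrix.vecMul_vecMul, Fin.sum_univ_succ]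
    set P := (List.ofFn fun i => K (Fin.succ i)).prod
    set P' := (List.ofFn fun i => K' (Fin.succ i)).prod
    -- The first-step difference is followed by `P'`, which is stochastic and so does not increase
    -- it; the rest starts from the law under `K`, so every error is weighted by paths of `K` alone.
    have hsplit : Matrix.vecMul (Matrix.vecMul ν (K 0)) P - Matrix.vecMul (Matrix.vecMul ν (K' 0)) P'
        = Matrix.vecMul (Matrix.vecMul ν (K 0 - K' 0)) P' +
          (Matrix.vecMul (Matrix.vecMul ν (K 0)) P - Matrix.vecMul (Matrix.vecMul ν (K 0)) P') := by
      rw [Matrix.vecMul_sub, Matrix.sub_vecMul]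
      abel
    rw [hsplit]
    refine (l1norm_add_le _ _).trans (add_le_add ?_ ?_)
    · refine (l1norm_vecMul_le_of_stochastic _
        (prod_ofFn_mem_stdSimplex fun n => hK' n.succ)).trans ((l1norm_vecMul_le _ _).trans ?_)
      refine le_of_eq ?_
      refine Eq.trans ?_ (sum_pathWeight_pair_zero ν hK fun a _ => l1norm (K 0 a - K' 0 a)).symm
      refine Finset.sum_congr rfl fun a _ => ?_
      rw [← Finset.sum_mul, (hK 0 a).2, one_mul, abs_of_nonneg (hν a)]
      rfl
    · have h := ih (ν := Matrix.vecMul ν (K 0)) (K := fun n => K n.succ) (K' := fun n => K' n.succ)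
        (fun b => Finset.sum_nonneg fun a _ => mul_nonneg (hν a) ((hK 0 a).1 b))
        (fun n => hK n.succ) (fun n => hK' n.succ)
      refine h.trans (le_of_eq (Finset.sum_congr rfl fun m _ => ?_))
      exact (sum_pathWeight_tail ν K fun y =>
        l1norm (K m.succ (y m.castSucc) - K' m.succ (y m.castSucc))).symm

end Stochastic

end PeriodicMDP

/-! ### Exponential supermartingales and Azuma–Hoeffding -/

namespace PeriodicMDP

/-- Hoeffding's lemma for a probability vector. -/
lemma sum_mul_exp_le {ι : Type*} [Fintype ι] {w f : ι → ℝ} {a b : ℝ} (hw : w ∈ stdSimplex ℝ ι)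
    (hf : ∀ i, f i ∈ Set.Icc a b) (l : ℝ) :
    ∑ i, w i * Real.exp (l * (f i - ∑ j, w j * f j)) ≤ Real.exp (l ^ 2 * (b - a) ^ 2 / 8) := by
  let _ : MeasurableSpace ι := ⊤
  set μ : Measure ι := ∑ i, ENNReal.ofReal (w i) • Measure.dirac i with hμ
  have hint : ∀ F : ι → ℝ, ∫ i, F i ∂μ = ∑ i, w i * F i := fun F => by
    rw [hμ, integral_finsetSum_measure]
    · refine Finset.sum_congr rfl fun i _ => ?_
      rw [integral_smul_measure, integral_dirac, ENNReal.toReal_ofReal (hw.1 i), smul_eq_mul]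
    · intro i _
      exact (integrable_dirac (by simp)).smul_measure ENNReal.ofReal_ne_top
  have hprob : IsProbabilityMeasure μ := ⟨by
    simp only [hμ, Measure.coe_finsetSum, Measure.coe_smul, Finset.sum_apply, Pi.smul_apply,
      measure_univ, smul_eq_mul, mul_one]
    rw [← ENNReal.ofReal_sum_of_nonneg fun i _ => hw.1 i, hw.2, ENNReal.ofReal_one]⟩
  have hsub := ProbabilityTheory.hasSubgaussianMGF_of_mem_Icc (μ := μ) (X := f) (a := a) (b := b)
    (measurable_of_finite f).aemeasurable (Filter.Eventually.of_forall hf)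
  have hle := hsub.mgf_le l
  rw [ProbabilityTheory.mgf, hint, hint] at hle
  refine hle.trans (le_of_eq ?_)
  congr 1
  push_cast
  rw [Real.norm_eq_abs, div_pow, sq_abs]
  ring

section Supermartingale

variable {Ω Y : Type*} {mΩ : MeasurableSpace Ω} [Fintype Y]

/-- For `t < T`, the random variable `τ t` is known at time `t + 1` and has the conditional
distribution `w t` given the information at time `t`. -/
structure HasCondWeights (ℙ : Measure Ω) (𝓖 : Filtration ℕ mΩ) (T : ℕ) (τ : ℕ → Ω → Y)
    (w : ℕ → Ω → Y → ℝ) : Prop where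
  measurableSet : ∀ t < T, ∀ y, MeasurableSet[𝓖 (t + 1)] {ω | τ t ω = y}
  condExp : ∀ t < T, ∀ y,
    ℙ[Set.indicator {ω | τ t ω = y} (fun _ => (1 : ℝ)) | 𝓖 t] =ᵐ[ℙ] fun ω => w t ω y

variable {ℙ : Measure Ω} [IsProbabilityMeasure ℙ] {𝓖 : Filtration ℕ mΩ} {T : ℕ}
  {τ : ℕ → Ω → Y} {w : ℕ → Ω → Y → ℝ}

omit [IsProbabilityMeasure ℙ] in
lemma HasCondWeights.measurable_comp (h : HasCondWeights ℙ 𝓖 T τ w) {t : ℕ} (ht : t < T)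
    {g : Y → Ω → ℝ} (hg : ∀ y, Measurable[𝓖 (t + 1)] (g y)) :
    Measurable[𝓖 (t + 1)] fun ω => g (τ t ω) ω := by
  classical
  have heq : (fun ω => g (τ t ω) ω) = fun ω => ∑ y, if τ t ω = y then g y ω else 0 := by
    funext ω
    simp
  rw [heq]
  exact Finset.measurable_sum _ fun y _ =>
    Measurable.ite (h.measurableSet t ht y) (hg y) measurable_const

/-- Split over the finitely many values of `τ t`, pull the bounded `𝓖 t`-measurable factor out of
the conditional expectation, and integrate. -/
lemma HasCondWeights.integral_mul (h : HasCondWeights ℙ 𝓖 T τ w) {t : ℕ} (ht : t < T)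
    {g : Y → Ω → ℝ} (hg : ∀ y, Measurable[𝓖 t] (g y)) {C : ℝ} (hC : ∀ y ω, |g y ω| ≤ C) :
    Integrable (fun ω => ∑ y, g y ω * w t ω y) ℙ ∧
      ∫ ω, g (τ t ω) ω ∂ℙ = ∫ ω, ∑ y, g y ω * w t ω y ∂ℙ := by
  classical
  have hS : ∀ y, MeasurableSet {ω | τ t ω = y} := fun y => 𝓖.le _ _ (h.measurableSet t ht y)
  have hI : ∀ y, Integrable (Set.indicator {ω | τ t ω = y} (fun _ => (1 : ℝ))) ℙ := fun y =>
    (integrable_const (1 : ℝ)).indicator (hS y)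
  have hce : ∀ y, ℙ[g y * Set.indicator {ω | τ t ω = y} (fun _ => (1 : ℝ)) | 𝓖 t] =ᵐ[ℙ]
      fun ω => g y ω * w t ω y := fun y => by
    refine (condExp_stronglyMeasurable_mul_of_bound (𝓖.le t) (hg y).stronglyMeasurable (hI y) C
      (Filter.Eventually.of_forall (hC y))).trans ?_
    filter_upwards [h.condExp t ht y] with ω hω
    rw [Pi.mul_apply, hω]
  have hint : ∀ y, Integrable (fun ω => g y ω * w t ω y) ℙ := fun y =>
    integrable_condExp.congr (hce y)
  have hint' : ∀ y, Integrable (g y * Set.indicator {ω | τ t ω = y} (fun _ => (1 : ℝ))) ℙ :=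
    fun y => (hI y).bdd_mul ((hg y).mono (𝓖.le t) le_rfl).aestronglyMeasurable
      (Filter.Eventually.of_forall (hC y))
  refine ⟨integrable_finsetSum _ fun y _ => hint y, ?_⟩
  rw [integral_finsetSum _ fun y _ => hint y]
  have heq : (fun ω => g (τ t ω) ω) =
      fun ω => ∑ y, (g y * Set.indicator {ω | τ t ω = y} (fun _ => (1 : ℝ))) ω := by
    funext ω
    simp [Set.indicator_apply]
  rw [heq, integral_finsetSum _ fun y _ => hint' y]
  refine Finset.sum_congr rfl fun y _ => ?_
  rw [← integral_condExp (𝓖.le t), integral_congr_ae (hce y)]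

/-- A product of adapted factors with conditional expectations at most one is a
supermartingale. -/
lemma HasCondWeights.integral_prod_le_one (h : HasCondWeights ℙ 𝓖 T τ w) {g : ℕ → Y → Ω → ℝ}
    {C : ℝ} (hg0 : ∀ t < T, ∀ y ω, 0 ≤ g t y ω) (hgC : ∀ t < T, ∀ y ω, g t y ω ≤ C)
    (hgm : ∀ t < T, ∀ y, Measurable[𝓖 t] (g t y))
    (hg1 : ∀ t < T, ∀ ω, ∑ y, w t ω y * g t y ω ≤ 1) {t : ℕ} (ht : t ≤ T) :
    Measurable[𝓖 t] (fun ω => ∏ s ∈ Finset.range t, g s (τ s ω) ω) ∧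
      ∫ ω, ∏ s ∈ Finset.range t, g s (τ s ω) ω ∂ℙ ≤ 1 := by
  induction t with
  | zero => simp
  | succ t ih =>
    have htT : t < T := ht
    obtain ⟨ihm, ihi⟩ := ih htT.le
    set V : Ω → ℝ := fun ω => ∏ s ∈ Finset.range t, g s (τ s ω) ω with hV
    have hV0 : ∀ ω, 0 ≤ V ω := fun ω => Finset.prod_nonneg fun s hs =>
      hg0 s ((Finset.mem_range.1 hs).trans htT) _ _
    have hVC : ∀ ω, V ω ≤ C ^ t := fun ω => by
      refine (Finset.prod_le_prod (fun s hs => hg0 s ((Finset.mem_range.1 hs).trans htT) _ _)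
        fun s hs => hgC s ((Finset.mem_range.1 hs).trans htT) _ _).trans (le_of_eq ?_)
      rw [Finset.prod_const, Finset.card_range]
    simp_rw [Finset.prod_range_succ]
    have hmul : ∀ y, Measurable[𝓖 t] fun ω => V ω * g t y ω := fun y => ihm.mul (hgm t htT y)
    constructor
    · exact h.measurable_comp htT (g := fun y ω => V ω * g t y ω)
        fun y => (hmul y).mono (𝓖.mono (Nat.le_succ t)) le_rfl
    · obtain ⟨hi, he⟩ := h.integral_mul htT hmul (C := C ^ t * C) fun y ω => by
        rw [abs_of_nonneg (mul_nonneg (hV0 ω) (hg0 t htT y ω))]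
        exact mul_le_mul (hVC ω) (hgC t htT y ω) (hg0 t htT y ω) ((hV0 ω).trans (hVC ω))
      refine he.trans_le (le_trans (integral_mono hi ?_ fun ω => ?_) ihi)
      · exact Integrable.of_bound (ihm.mono (𝓖.le t) le_rfl).aestronglyMeasurable (C ^ t)
          (Filter.Eventually.of_forall fun ω => by
            rw [Real.norm_eq_abs, abs_of_nonneg (hV0 ω)]; exact hVC ω)
      · have h1 := mul_le_mul_of_nonneg_left (hg1 t htT ω) (hV0 ω)
        rw [mul_one, Finset.mul_sum] at h1
        refine le_trans (le_of_eq (Finset.sum_congr rfl fun y _ => ?_)) h1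
        ring

/-- Exponential Markov inequality for an adapted supermartingale product. -/
lemma HasCondWeights.measureReal_le_exp (h : HasCondWeights ℙ 𝓖 T τ w) {g : ℕ → Y → Ω → ℝ}
    {C : ℝ} (hgC : ∀ t < T, ∀ y ω, g t y ω ≤ C)
    (hgm : ∀ t < T, ∀ y, Measurable[𝓖 t] (g t y))
    (hg1 : ∀ t < T, ∀ ω, ∑ y, w t ω y * Real.exp (g t y ω) ≤ 1) (u : ℝ) :
    ℙ.real {ω | u ≤ ∑ t ∈ Finset.range T, g t (τ t ω) ω} ≤ Real.exp (-u) := by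
  obtain ⟨hm, hi⟩ := h.integral_prod_le_one (g := fun t y ω => Real.exp (g t y ω))
    (C := Real.exp C) (fun t _ y ω => (Real.exp_pos _).le)
    (fun t ht y ω => Real.exp_le_exp.2 (hgC t ht y ω)) (fun t ht y => (hgm t ht y).exp)
    hg1 le_rfl
  have hnn : ∀ ω, 0 ≤ ∏ t ∈ Finset.range T, Real.exp (g t (τ t ω) ω) := fun ω =>
    Finset.prod_nonneg fun t _ => (Real.exp_pos _).le
  have hint : Integrable (fun ω => ∏ t ∈ Finset.range T, Real.exp (g t (τ t ω) ω)) ℙ :=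
    Integrable.of_bound (hm.mono (𝓖.le T) le_rfl).aestronglyMeasurable (Real.exp C ^ T)
      (Filter.Eventually.of_forall fun ω => by
        rw [Real.norm_eq_abs, abs_of_nonneg (hnn ω)]
        refine (Finset.prod_le_prod (fun s _ => (Real.exp_pos _).le)
          fun s hs => Real.exp_le_exp.2 (hgC s (Finset.mem_range.1 hs) _ _)).trans (le_of_eq ?_)
        rw [Finset.prod_const, Finset.card_range])
  have hmk := mul_meas_ge_le_integral_of_nonneg (Filter.Eventually.of_forall hnn) hint (Real.exp u)
  have hset : {ω | u ≤ ∑ t ∈ Finset.range T, g t (τ t ω) ω} =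
      {ω | Real.exp u ≤ ∏ t ∈ Finset.range T, Real.exp (g t (τ t ω) ω)} := by
    ext ω
    rw [Set.mem_ofPred_eq, Set.mem_ofPred_eq, ← Real.exp_sum, Real.exp_le_exp]
  rw [hset, Real.exp_neg, ← one_div, le_div_iff₀ (Real.exp_pos u), mul_comm]
  exact hmk.trans hi

/-- Azuma–Hoeffding inequality for the deviation of predictable functions with values in
`[0, 2]` from their conditional means. -/
lemma HasCondWeights.measureReal_sum_sub_ge_le (h : HasCondWeights ℙ 𝓖 T τ w) (hT : 0 < T)
    (hw : ∀ t < T, ∀ ω, w t ω ∈ stdSimplex ℝ Y) (hwm : ∀ t < T, ∀ y, Measurable[𝓖 t] (w t · y))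
    {D : ℕ → Y → Ω → ℝ} (hD : ∀ t < T, ∀ y ω, D t y ω ∈ Set.Icc 0 2)
    (hDm : ∀ t < T, ∀ y, Measurable[𝓖 t] (D t y)) {ε : ℝ} (hε : 0 ≤ ε) :
    ℙ.real {ω | ε ≤ ∑ t ∈ Finset.range T, ((∑ y, w t ω y * D t y ω) - D t (τ t ω) ω)} ≤
      Real.exp (-(ε ^ 2 / (2 * T))) := by
  have hT' : (0 : ℝ) < T := Nat.cast_pos.2 hT
  -- The minimiser of `T * l ^ 2 / 2 - l * ε`, where `l ^ 2 / 2` is Hoeffding's exponent `l ^ 2 * (2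
  -- - 0) ^ 2 / 8`.
  set l : ℝ := ε / T with hl
  have hl0 : 0 ≤ l := div_nonneg hε hT'.le
  have hlT : l * T = ε := div_mul_cancel₀ _ hT'.ne'
  have hmean : ∀ t < T, ∀ ω, ∑ y, w t ω y * D t y ω ≤ 2 := fun t ht ω => by
    calc ∑ y, w t ω y * D t y ω ≤ ∑ y, w t ω y * 2 := Finset.sum_le_sum fun y _ =>
          mul_le_mul_of_nonneg_left (hD t ht y ω).2 ((hw t ht ω).1 y)
      _ = 2 := by rw [← Finset.sum_mul, (hw t ht ω).2, one_mul]
  have key := h.measureReal_le_exp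
    (g := fun t y ω => l * ((∑ z, w t ω z * D t z ω) - D t y ω) - l ^ 2 / 2) (C := l * 2)
    (fun t ht y ω => by
      have h1 := mul_le_mul_of_nonneg_left
        (sub_le_sub (hmean t ht ω) (hD t ht y ω).1) hl0
      have h2 := sq_nonneg l
      linarith)
    (fun t ht y => by
      refine (Measurable.const_mul (Measurable.sub ?_ (hDm t ht y)) l).sub_const _
      exact Finset.measurable_sum _ fun z _ => (hwm t ht z).mul (hDm t ht z))
    (fun t ht ω => by
      have h1 := sum_mul_exp_le (hw t ht ω) (fun y => hD t ht y ω) (-l)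
      simp_rw [Real.exp_sub, ← mul_div_assoc]
      rw [← Finset.sum_div, div_le_one (Real.exp_pos _)]
      refine le_trans (le_of_eq ?_) (h1.trans (le_of_eq ?_))
      · refine Finset.sum_congr rfl fun y _ => ?_
        congr 2
        ring
      · congr 1
        ring)
    (ε ^ 2 / (2 * T))
  refine le_trans (measureReal_mono fun ω hω => ?_) key
  rw [Set.mem_ofPred_eq] at hω ⊢
  rw [Finset.sum_sub_distrib, ← Finset.mul_sum, Finset.sum_const, Finset.card_range, nsmul_eq_mul]
  have h1 := mul_le_mul_of_nonneg_left hω hl0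
  have h2 : ε ^ 2 / (2 * T) = l * ε - T * (l ^ 2 / 2) := by
    rw [hl]
    field_simp
    ring
  linarith

end Supermartingale

end PeriodicMDP

/-! ### Visit counts and the empirical kernel -/

namespace PeriodicMDP

variable {X A : Type*} [Fintype X] [Fintype A] [DecidableEq X] [DecidableEq A] {N : ℕ}

section Counts

omit [DecidableEq X] [DecidableEq A] in
lemma stepMatrix_mem_stdSimplex {p : Fin N → X × A → X → ℝ} {π : Fin N → X → A → ℝ}
    (hp : IsKernel p) (hπ : IsPolicy π) (n : Fin N) (y : X × A) :
    stepMatrix p π n y ∈ stdSimplex ℝ (X × A) := by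
  refine ⟨fun z => mul_nonneg ((hp n y).1 _) ((hπ n _).1 _), ?_⟩
  rw [Fintype.sum_prod_type, ← (hp n y).2]
  refine Finset.sum_congr rfl fun x _ => ?_
  simp only [stepMatrix, Matrix.of_apply]
  rw [← Finset.mul_sum, (hπ n x).2, mul_one]

omit [DecidableEq X] [DecidableEq A] in
-- Both matrices carry the same policy factor, which sums to one over the actions.
lemma l1norm_stepMatrix_sub (p p' : Fin N → X × A → X → ℝ) {π : Fin N → X → A → ℝ}
    (hπ : IsPolicy π) (n : Fin N) (y : X × A) :
    l1norm (stepMatrix p π n y - stepMatrix p' π n y) = l1norm (p n y - p' n y) := by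
  unfold l1norm
  rw [Fintype.sum_prod_type]
  refine Finset.sum_congr rfl fun x _ => ?_
  simp only [stepMatrix, Matrix.of_apply, Pi.sub_apply]
  simp_rw [← sub_mul, abs_mul, abs_of_nonneg ((hπ n x).1 _)]
  rw [← Finset.mul_sum, (hπ n x).2, mul_one]

variable (τ : ℕ → Fin (N + 1) → X × A)

omit [Fintype X] [Fintype A] in
lemma visitCount_succ (t : ℕ) (n : Fin N) (y : X × A) :
    visitCount τ (t + 1) n y = visitCount τ t n y + if τ t n.castSucc = y then 1 else 0 := by
  simp only [visitCount, Finset.card_filter, Finset.sum_range_succ]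

omit [Fintype X] [Fintype A] in
lemma visitCount_mono (n : Fin N) (y : X × A) : Monotone fun t => visitCount τ t n y :=
  monotone_nat_of_le_succ fun t => by rw [visitCount_succ]; exact Nat.le_add_right _ _

omit [Fintype X] [Fintype A] in
lemma visitCount_le (t : ℕ) (n : Fin N) (y : X × A) : visitCount τ t n y ≤ t := by
  exact (Finset.card_filter_le _ _).trans (Finset.card_range t).le

lemma sum_visitCount (t : ℕ) (n : Fin N) : ∑ y, visitCount τ t n y = t := by
  simp only [visitCount, Finset.card_filter]
  rw [Finset.sum_comm]
  simp

omit [Fintype A] in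
lemma sum_ite_visit_eq_sum_transitionCount (F : X → ℝ) (t : ℕ) (n : Fin N)
    (y : X × A) :
    ∑ s ∈ Finset.range t, (if τ s n.castSucc = y then F (τ s n.succ).1 else 0) =
      ∑ x, (transitionCount τ t n y x : ℝ) * F x := by
  simp only [transitionCount, Finset.card_filter, Nat.cast_sum, Finset.sum_mul]
  rw [Finset.sum_comm]
  refine Finset.sum_congr rfl fun s _ => ?_
  by_cases h : τ s n.castSucc = y <;> simp [h]

omit [Fintype A] in
lemma sum_transitionCount (t : ℕ) (n : Fin N) (y : X × A) :
    ∑ x, (transitionCount τ t n y x : ℝ) = visitCount τ t n y := by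
  have h := sum_ite_visit_eq_sum_transitionCount τ (fun _ => 1) t n y
  simp only [mul_one] at h
  rw [← h, visitCount, Finset.card_filter]
  push_cast
  rfl

omit [Fintype A] in
lemma mul_empiricalKernel (t : ℕ) (n : Fin N) (y : X × A) (x : X) (h : visitCount τ t n y ≠ 0) :
    visitCount τ t n y * empiricalKernel τ t n y x = transitionCount τ t n y x := by
  have h1 : (1 : ℝ) ≤ visitCount τ t n y := Nat.one_le_cast.2 (Nat.one_le_iff_ne_zero.2 h)
  rw [empiricalKernel, if_neg h, max_eq_right h1, mul_div_cancel₀ _ (by linarith)]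

omit [Fintype A] in
lemma isKernel_empiricalKernel (t : ℕ) : IsKernel (empiricalKernel τ t) := by
  intro n y
  have : Nonempty X := ⟨y.1⟩
  by_cases h : visitCount τ t n y = 0
  · have heq : empiricalKernel τ t n y = fun _ => 1 / (Fintype.card X : ℝ) := by
      funext x
      rw [empiricalKernel, if_pos h]
    rw [heq]
    refine ⟨fun x => by positivity, ?_⟩
    simp
  · have h1 : (visitCount τ t n y : ℝ) ≠ 0 := Nat.cast_ne_zero.2 h
    refine ⟨fun x => ?_, ?_⟩
    · rw [empiricalKernel, if_neg h]
      positivity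
    · apply mul_left_cancel₀ h1
      rw [Finset.mul_sum, mul_one]
      refine Eq.trans ?_ (sum_transitionCount τ t n y)
      exact Finset.sum_congr rfl fun x _ => mul_empiricalKernel τ t n y x h

omit [Fintype X] [Fintype A] in
/-- Summing over the transitions out of `y` until `m` of them have been observed gives the sum
over the first `t` episodes, if there are `m` visits of `y` in these. -/
lemma sum_truncated_visits {t T m : ℕ} (ht : t ≤ T) (n : Fin N) (y : X × A)
    (hm : visitCount τ t n y = m) (F : X → ℝ) :
    ∑ s ∈ Finset.range T,
        (if visitCount τ s n y < m ∧ τ s n.castSucc = y then F (τ s n.succ).1 else 0) =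
      ∑ s ∈ Finset.range t, (if τ s n.castSucc = y then F (τ s n.succ).1 else 0) := by
  rw [← Finset.sum_range_add_sum_Ico _ ht]
  have h2 : ∑ s ∈ Finset.Ico t T,
      (if visitCount τ s n y < m ∧ τ s n.castSucc = y then F (τ s n.succ).1 else 0) = 0 := by
    -- From episode `t` on the count is already at least `m`, so the truncation has switched the sum
    -- off.
    refine Finset.sum_eq_zero fun s hs => if_neg fun hlt => ?_
    have := visitCount_mono τ n y (Finset.mem_Ico.1 hs).1
    simp only [hm] at this
    omega
  rw [h2, add_zero]
  refine Finset.sum_congr rfl fun s hs => if_congr ⟨fun h => h.2, fun h => ⟨?_, h⟩⟩ rfl rfl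
  have h1 := visitCount_mono τ n y (Nat.succ_le_of_lt (Finset.mem_range.1 hs))
  simp only [Nat.succ_eq_add_one, visitCount_succ, if_pos h, hm] at h1
  omega

/-- Pigeonhole bound for the confidence widths at the visited pairs. -/
lemma sum_width_le {c : ℝ} (hc : 2 / 3 ≤ c) (T : ℕ) (n : Fin N) :
    ∑ t ∈ Finset.range T, (if visitCount τ t n (τ t n.castSucc) = 0 then 2
        else c / √(visitCount τ t n (τ t n.castSucc) : ℝ)) ≤
      3 * c * ∑ y, √(visitCount τ T n y : ℝ) := by
  induction T with
  | zero => simp [visitCount]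
  | succ T ih =>
    rw [Finset.sum_range_succ]
    set z := τ T n.castSucc with hz
    set k := visitCount τ T n z with hk
    have hsum : ∑ y, √(visitCount τ (T + 1) n y : ℝ) =
        ∑ y, √(visitCount τ T n y : ℝ) + (√((k : ℝ) + 1) - √(k : ℝ)) := by
      rw [← sub_eq_iff_eq_add', ← Finset.sum_sub_distrib, Finset.sum_eq_single z]
      · rw [visitCount_succ, ← hz, if_pos rfl, ← hk]
        push_cast
        rfl
      · intro y _ hy
        rw [visitCount_succ, ← hz, if_neg hy.symm, add_zero, sub_self]
      · simp
    rw [hsum, mul_add]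
    refine add_le_add ih ?_
    split_ifs with h0
    -- First visit: the trivial error 2 is charged to `3 * c * (√1 - √0)`, which needs `2 / 3 ≤ c`.
    · rw [h0]
      simp only [Nat.cast_zero, zero_add, Real.sqrt_one, Real.sqrt_zero]
      linarith
    · have hk0 : (1 : ℝ) ≤ k := Nat.one_le_cast.2 (Nat.one_le_iff_ne_zero.2 h0)
      have hs0 : 0 < √(k : ℝ) := Real.sqrt_pos.2 (by linarith)
      have hs1 := Real.sq_sqrt (show (0 : ℝ) ≤ k by linarith)
      have hs2 := Real.sq_sqrt (show (0 : ℝ) ≤ k + 1 by linarith)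
      have hle : √((k : ℝ) + 1) ≤ 2 * √(k : ℝ) := by
        rw [Real.sqrt_le_left (by positivity)]
        rw [mul_pow, hs1]
        linarith
      have hge : √(k : ℝ) ≤ √((k : ℝ) + 1) := Real.sqrt_le_sqrt (by linarith)
      rw [div_le_iff₀ hs0]
      -- Here `1 = (√(k+1) - √k)(√(k+1) + √k)`, and the second factor is at most `3√k` by `hle`.
      have hone : 1 ≤ 3 * (√((k : ℝ) + 1) - √(k : ℝ)) * √(k : ℝ) := by
        have h3 := mul_nonneg (sub_nonneg.2 hge) (sub_nonneg.2 hle)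
        nlinarith
      calc c = c * 1 := (mul_one c).symm
        _ ≤ c * (3 * (√((k : ℝ) + 1) - √(k : ℝ)) * √(k : ℝ)) :=
            mul_le_mul_of_nonneg_left hone (by linarith)
        _ = _ := by ring

/-- Cauchy–Schwarz over the pairs, the visits at a fixed step totalling `T`. -/
lemma sum_sqrt_visitCount_le (T : ℕ) (n : Fin N) :
    ∑ y, √(visitCount τ T n y : ℝ) ≤ √((Fintype.card X : ℝ) * Fintype.card A * T) := by
  refine Real.le_sqrt_of_sq_le ?_
  have h := sq_sum_le_card_mul_sum_sq (s := Finset.univ) (f := fun y => √(visitCount τ T n y : ℝ))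
  simp only [Real.sq_sqrt (Nat.cast_nonneg _)] at h
  rw [← Nat.cast_sum, sum_visitCount, Finset.card_univ, Fintype.card_prod, Nat.cast_mul] at h
  exact h

end Counts

/-! ### Measurability with respect to the past -/

section Measurability

variable {Ω : Type*} {m : MeasurableSpace Ω} {τ : ℕ → Ω → Fin (N + 1) → X × A} {t : ℕ}

omit [DecidableEq X] [DecidableEq A] in
lemma measurableSet_trajectory {s : ℕ} (hτ : ∀ y, MeasurableSet {ω | τ s ω = y})
    (S : Set (Fin (N + 1) → X × A)) : MeasurableSet {ω | τ s ω ∈ S} := by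
  have heq : {ω | τ s ω ∈ S} = ⋃ y ∈ S, {ω | τ s ω = y} := by
    ext ω
    simp
  rw [heq]
  exact MeasurableSet.biUnion (Set.to_countable S) fun y _ => hτ y

lemma measurable_visitCount (hτ : ∀ s < t, ∀ y, MeasurableSet {ω | τ s ω = y}) (n : Fin N)
    (y : X × A) : Measurable fun ω => visitCount (fun s => τ s ω) t n y := by
  simp only [visitCount, Finset.card_filter]
  exact Finset.measurable_sum _ fun s hs => Measurable.ite
    (measurableSet_trajectory (hτ s (Finset.mem_range.1 hs)) {z | z n.castSucc = y})
    measurable_const measurable_const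

lemma measurable_transitionCount (hτ : ∀ s < t, ∀ y, MeasurableSet {ω | τ s ω = y}) (n : Fin N)
    (y : X × A) (x : X) : Measurable fun ω => transitionCount (fun s => τ s ω) t n y x := by
  simp only [transitionCount, Finset.card_filter]
  exact Finset.measurable_sum _ fun s hs => Measurable.ite
    (measurableSet_trajectory (hτ s (Finset.mem_range.1 hs))
      {z | z n.castSucc = y ∧ (z n.succ).1 = x})
    measurable_const measurable_const

lemma measurable_empiricalKernel (hτ : ∀ s < t, ∀ y, MeasurableSet {ω | τ s ω = y}) (n : Fin N)
    (y : X × A) (x : X) : Measurable fun ω => empiricalKernel (fun s => τ s ω) t n y x := by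
  have h1 := measurable_visitCount hτ n y
  have h2 : Measurable fun ω => (visitCount (fun s => τ s ω) t n y : ℝ) :=
    measurable_from_top.comp h1
  have h3 : Measurable fun ω => (transitionCount (fun s => τ s ω) t n y x : ℝ) :=
    measurable_from_top.comp (measurable_transitionCount hτ n y x)
  exact Measurable.ite (h1 (measurableSet_singleton 0)) measurable_const
    (h3.div (measurable_const.max h2))

lemma measurable_l1norm_sub_empiricalKernel (hτ : ∀ s < t, ∀ y, MeasurableSet {ω | τ s ω = y})
    (v : X → ℝ) (n : Fin N) (y : X × A) :
    Measurable fun ω => l1norm (v - empiricalKernel (fun s => τ s ω) t n y) :=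
  Finset.measurable_sum _ fun x _ => ((measurable_empiricalKernel hτ n y x).const_sub (v x)).abs

lemma measurable_prod_ofFn {Y : Type*} [Fintype Y] [DecidableEq Y]
    {K : Ω → Fin N → Matrix Y Y ℝ} (hK : ∀ n a b, Measurable fun ω => K ω n a b) (a b : Y) :
    Measurable fun ω => (List.ofFn (K ω)).prod a b := by
  induction N generalizing a b with
  | zero => simp
  | succ N ih =>
    simp only [List.ofFn_succ, List.prod_cons, Matrix.mul_apply]
    exact Finset.measurable_sum _ fun c _ => (hK 0 a c).mul
      (ih (K := fun ω n => K ω n.succ) (fun n => hK n.succ) c b)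

/-- Only episodes before `t` enter. The σ-algebra is left free so that it can be `𝓖 t`, which makes
the estimate predictable. -/
lemma measurable_estInit {π : ℕ → Ω → Fin N → X → A → ℝ} (ρ : X × A → ℝ)
    (hπ : ∀ s < t, ∀ n x a, Measurable fun ω => π s ω n x a)
    (hτ : ∀ s < t, ∀ y, MeasurableSet {ω | τ s ω = y}) (y : X × A) :
    Measurable fun ω => estInit ρ (fun s => π s ω) (fun s => τ s ω) t y := by
  induction t generalizing y with
  | zero => exact measurable_const
  | succ t ih =>
    simp only [estInit, Matrix.vecMul, dotProduct]
    have hτ' : ∀ s < t, ∀ y, MeasurableSet {ω | τ s ω = y} := fun s hs =>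
      hτ s (hs.trans t.lt_succ_self)
    refine Finset.measurable_sum _ fun z _ =>
      (ih (fun s hs => hπ s (hs.trans t.lt_succ_self)) hτ' z).mul ?_
    refine measurable_prod_ofFn (fun n a b => ?_) z y
    exact (measurable_empiricalKernel hτ' n a b.1).mul (hπ t t.lt_succ_self n b.1 b.2)

end Measurability

/-! ### Contraction recursion for the initial distributions -/

section Regret

lemma trueInit_mem_stdSimplex {p : Fin N → X × A → X → ℝ} (hp : IsKernel p) {ρ : X × A → ℝ}
    (hρ : ρ ∈ stdSimplex ℝ (X × A)) {π : ℕ → Fin N → X → A → ℝ} {t : ℕ}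
    (hπ : ∀ s < t, IsPolicy (π s)) : trueInit p ρ π t ∈ stdSimplex ℝ (X × A) := by
  induction t with
  | zero => exact hρ
  | succ t ih =>
    exact vecMul_mem_stdSimplex (ih fun s hs => hπ s (hs.trans t.lt_succ_self))
      (prod_ofFn_mem_stdSimplex (stepMatrix_mem_stdSimplex hp (hπ t t.lt_succ_self)))

lemma estInit_mem_stdSimplex {ρ : X × A → ℝ} (hρ : ρ ∈ stdSimplex ℝ (X × A))
    {π : ℕ → Fin N → X → A → ℝ} (τ : ℕ → Fin (N + 1) → X × A) {t : ℕ}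
    (hπ : ∀ s < t, IsPolicy (π s)) : estInit ρ π τ t ∈ stdSimplex ℝ (X × A) := by
  induction t with
  | zero => exact hρ
  | succ t ih =>
    exact vecMul_mem_stdSimplex (ih fun s hs => hπ s (hs.trans t.lt_succ_self))
      (prod_ofFn_mem_stdSimplex
        (stepMatrix_mem_stdSimplex (isKernel_empiricalKernel τ t) (hπ t t.lt_succ_self)))

/-- Since `d 0 = 0`, the sum of `d` is at most its shifted sum; inserting the recursion there and
solving for the sum avoids unrolling it. -/
lemma sum_le_of_contraction {α : ℝ} (hα1 : α < 1) {d e : ℕ → ℝ}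
    (hd : ∀ t, 0 ≤ d t) (hd0 : d 0 = 0) {T : ℕ} (h : ∀ t < T, d (t + 1) ≤ α * d t + e t) :
    ∑ t ∈ Finset.range T, d t ≤ (1 - α)⁻¹ * ∑ t ∈ Finset.range T, e t := by
  have h1 : ∑ t ∈ Finset.range T, d t ≤ ∑ t ∈ Finset.range T, d (t + 1) := by
    have h2 := Finset.sum_range_succ' d T
    have h3 := Finset.sum_range_succ d T
    have h4 := hd T
    linarith
  have h2 : ∑ t ∈ Finset.range T, d (t + 1) ≤
      α * ∑ t ∈ Finset.range T, d t + ∑ t ∈ Finset.range T, e t := by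
    rw [Finset.mul_sum, ← Finset.sum_add_distrib]
    exact Finset.sum_le_sum fun t ht => h t (Finset.mem_range.1 ht)
  rw [inv_mul_eq_div, le_div_iff₀ (by linarith)]
  linarith

/-- The error of the estimated initial distributions is controlled by the expected estimation
errors of the kernel along the trajectories of the restarted agent. -/
lemma sum_l1norm_trueInit_sub_estInit_le {p : Fin N → X × A → X → ℝ} (hp : IsKernel p)
    {ρ : X × A → ℝ} (hρ : ρ ∈ stdSimplex ℝ (X × A)) {α : ℝ} (hα1 : α < 1)
    (hα : AllPolicyContraction p α) {π : ℕ → Fin N → X → A → ℝ} (τ : ℕ → Fin (N + 1) → X × A)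
    {T : ℕ} (hπ : ∀ t < T, IsPolicy (π t)) :
    ∑ t ∈ Finset.range T, l1norm (trueInit p ρ π t - estInit ρ π τ t) ≤
      (1 - α)⁻¹ * ∑ n, ∑ t ∈ Finset.range T,
        ∑ y, pathWeight (estInit ρ π τ t) (stepMatrix p (π t)) y *
          l1norm (p n (y n.castSucc) - empiricalKernel τ t n (y n.castSucc)) := by
  rw [Finset.sum_comm]
  refine sum_le_of_contraction hα1 (fun t => l1norm_nonneg _)
    (by simp [trueInit, estInit, l1norm]) fun t ht => ?_
  have hπ' : ∀ s < t, IsPolicy (π s) := fun s hs => hπ s (hs.trans ht)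
  have hest := estInit_mem_stdSimplex hρ τ hπ'
  have hsplit : trueInit p ρ π (t + 1) - estInit ρ π τ (t + 1) =
      (Matrix.vecMul (trueInit p ρ π t) (episodeMatrix p (π t)) -
        Matrix.vecMul (estInit ρ π τ t) (episodeMatrix p (π t))) +
      (Matrix.vecMul (estInit ρ π τ t) (episodeMatrix p (π t)) -
        Matrix.vecMul (estInit ρ π τ t) (episodeMatrix (empiricalKernel τ t) (π t))) := by
    rw [trueInit, estInit]
    abel
  rw [hsplit]
  refine (l1norm_add_le _ _).trans (add_le_add
    (hα _ (hπ t ht) _ (trueInit_mem_stdSimplex hp hρ hπ') _ hest) ?_)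
  refine (l1norm_vecMul_prod_sub_le hest.1 (stepMatrix_mem_stdSimplex hp (hπ t ht))
    (stepMatrix_mem_stdSimplex (isKernel_empiricalKernel τ t) (hπ t ht))).trans (le_of_eq ?_)
  refine Finset.sum_congr rfl fun n _ => Finset.sum_congr rfl fun y _ => ?_
  rw [← l1norm_stepMatrix_sub _ _ (hπ t ht)]

end Regret

end PeriodicMDP

/-! ### Concentration along the restarted trajectories -/

namespace PeriodicMDP

variable {X A : Type*} [Fintype X] [Fintype A] [DecidableEq X] [DecidableEq A] {N : ℕ}

section Concentration

omit [DecidableEq X] [DecidableEq A] in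
lemma sum_stepMatrix_mul_fst (p : Fin N → X × A → X → ℝ) {π : Fin N → X → A → ℝ}
    (hπ : IsPolicy π) (n : Fin N) (y : X × A) (F : X → ℝ) :
    ∑ z, stepMatrix p π n y z * F z.1 = ∑ x, p n y x * F x := by
  rw [Fintype.sum_prod_type]
  refine Finset.sum_congr rfl fun x _ => ?_
  simp only [stepMatrix, Matrix.of_apply]
  rw [← Finset.sum_mul, ← Finset.mul_sum, (hπ n x).2, mul_one]

variable {Ω : Type*} {mΩ : MeasurableSpace Ω} {ℙ : Measure Ω}
  {𝓖 : Filtration ℕ mΩ} {T : ℕ} {p : Fin N → X × A → X → ℝ} {ρ : X × A → ℝ}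
  {π : ℕ → Ω → Fin N → X → A → ℝ} {τ : ℕ → Ω → Fin (N + 1) → X × A}

/-- The conditional probability that the trajectory of episode `t` is `y`. -/
noncomputable def trajectoryWeight (p : Fin N → X × A → X → ℝ) (ρ : X × A → ℝ)
    (π : ℕ → Ω → Fin N → X → A → ℝ) (τ : ℕ → Ω → Fin (N + 1) → X × A) (t : ℕ) (ω : Ω)
    (y : Fin (N + 1) → X × A) : ℝ :=
  pathWeight (estInit ρ (fun s => π s ω) (fun s => τ s ω) t) (stepMatrix p (π t ω)) y

lemma IsRestartProtocol.hasCondWeights (h : IsRestartProtocol ℙ 𝓖 T p ρ π τ) :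
    HasCondWeights ℙ 𝓖 T τ (trajectoryWeight p ρ π τ) :=
  ⟨h.measurable_trajectory, h.law_trajectory⟩

lemma IsRestartProtocol.measurableSet_of_lt (h : IsRestartProtocol ℙ 𝓖 T p ρ π τ) {t : ℕ}
    (ht : t ≤ T) : ∀ s < t, ∀ y, MeasurableSet[𝓖 t] {ω | τ s ω = y} := fun s hs y =>
  𝓖.mono (Nat.succ_le_of_lt hs) _ (h.measurable_trajectory s (hs.trans_le ht) y)

lemma IsRestartProtocol.trajectoryWeight_mem_stdSimplex (h : IsRestartProtocol ℙ 𝓖 T p ρ π τ)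
    (hp : IsKernel p) (hρ : ρ ∈ stdSimplex ℝ (X × A)) {t : ℕ} (ht : t < T) (ω : Ω) :
    trajectoryWeight p ρ π τ t ω ∈ stdSimplex ℝ (Fin (N + 1) → X × A) := by
  have hest := estInit_mem_stdSimplex hρ (fun s => τ s ω) (t := t) (π := fun s => π s ω)
    fun s hs => h.isPolicy s (hs.trans ht) ω
  have hstep := stepMatrix_mem_stdSimplex hp (h.isPolicy t ht ω)
  exact ⟨pathWeight_nonneg hest.1 fun n a => (hstep n a).1,
    (sum_pathWeight _ hstep).trans hest.2⟩

lemma IsRestartProtocol.measurable_trajectoryWeight (h : IsRestartProtocol ℙ 𝓖 T p ρ π τ)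
    {t : ℕ} (ht : t < T) (y : Fin (N + 1) → X × A) :
    Measurable[𝓖 t] fun ω => trajectoryWeight p ρ π τ t ω y := by
  refine Measurable.mul (measurable_estInit (m := 𝓖 t) ρ (fun s hs n x a =>
    (h.measurable_policy s (hs.trans ht) n x a).mono (𝓖.mono hs.le) le_rfl)
    (h.measurableSet_of_lt ht.le) _) ?_
  exact Finset.measurable_prod _ fun n _ => (h.measurable_policy t ht n _ _).const_mul _

variable [IsProbabilityMeasure ℙ]

/-- Hoeffding inequality for the empirical probability of a set of states, computed from the
first `m` visits of a pair. -/
lemma IsRestartProtocol.measureReal_empirical_ge_le (h : IsRestartProtocol ℙ 𝓖 T p ρ π τ)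
    (hp : IsKernel p) (hρ : ρ ∈ stdSimplex ℝ (X × A)) (n : Fin N) (y : X × A) {m : ℕ}
    (hm : m ≠ 0) (S : Finset X) {ε : ℝ} (hε : 0 ≤ ε) :
    ℙ.real {ω | ∃ t < T, visitCount (fun s => τ s ω) t n y = m ∧
        ε ≤ ∑ x ∈ S, empiricalKernel (fun s => τ s ω) t n y x - ∑ x ∈ S, p n y x} ≤
      Real.exp (-(2 * m * ε ^ 2)) := by
  -- The exponent `l = 4ε` minimises `l ^ 2 / 8 - l * ε`; the compensator `2 * ε ^ 2` is `l ^ 2 / 8`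
  -- for an indicator.
  set F : X → ℝ := fun x =>
    4 * ε * ((if x ∈ S then 1 else 0) - ∑ z ∈ S, p n y z) - 2 * ε ^ 2 with hF
  have hS0 : 0 ≤ ∑ z ∈ S, p n y z := Finset.sum_nonneg fun z _ => (hp n y).1 z
  have hFle : ∀ x, F x ≤ 4 * ε := fun x => by
    have h1 : (if x ∈ S then (1 : ℝ) else 0) - ∑ z ∈ S, p n y z ≤ 1 := by
      split_ifs <;> linarith
    have h2 := mul_le_mul_of_nonneg_left h1 (by linarith : 0 ≤ 4 * ε)
    have h3 := sq_nonneg ε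
    simp only [hF]
    linarith
  have hFexp : ∑ x, p n y x * Real.exp (F x) ≤ 1 := by
    have h1 := sum_mul_exp_le (hp n y) (f := fun x => if x ∈ S then (1 : ℝ) else 0) (a := 0)
      (b := 1) (fun x => by split_ifs <;> norm_num) (4 * ε)
    simp only [mul_ite, mul_one, mul_zero, Finset.sum_ite_mem, Finset.univ_inter] at h1
    simp only [hF, Real.exp_sub, ← mul_div_assoc]
    rw [← Finset.sum_div, div_le_one (Real.exp_pos _)]
    refine h1.trans (le_of_eq ?_)
    congr 1
    ring
  have key := h.hasCondWeights.measureReal_le_exp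
    -- The condition on the count is known at time `t`, and it keeps only the first `m` visits. The
    -- full sum over `T` episodes thus handles every `t` with exactly `m` visits at once, without a
    -- union over `t`.
    (g := fun t z ω => if visitCount (fun s => τ s ω) t n y < m ∧ z n.castSucc = y
      then F (z n.succ).1 else 0) (C := 4 * ε)
    (fun t _ z ω => by
      split_ifs
      · exact hFle _
      · linarith)
    (fun t ht z => by
      refine Measurable.ite ?_ measurable_const measurable_const
      refine MeasurableSet.inter ?_ (MeasurableSet.const _)
      exact measurable_visitCount (m := 𝓖 t) (h.measurableSet_of_lt ht.le) n y measurableSet_Iio)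
    (fun t ht ω => by
      have hest := estInit_mem_stdSimplex hρ (fun s => τ s ω) (t := t) (π := fun s => π s ω)
        fun s hs => h.isPolicy s (hs.trans ht) ω
      have hstep := stepMatrix_mem_stdSimplex hp (h.isPolicy t ht ω)
      refine sum_pathWeight_pair_le hest hstep n (fun a b => Real.exp
        (if visitCount (fun s => τ s ω) t n y < m ∧ a = y then F b.1 else 0)) fun a => ?_
      by_cases hc : visitCount (fun s => τ s ω) t n y < m ∧ a = y
      · simp only [if_pos hc]
        rw [hc.2, sum_stepMatrix_mul_fst p (h.isPolicy t ht ω) n y fun x => Real.exp (F x)]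
        exact hFexp
      · simp only [if_neg hc, Real.exp_zero, mul_one]
        exact (hstep n a).2.le)
    (2 * m * ε ^ 2)
  refine le_trans (measureReal_mono ?_) key
  rintro ω ⟨t, ht, hv, hge⟩
  rw [Set.mem_ofPred_eq, sum_truncated_visits (fun s => τ s ω) ht.le n y hv F,
    sum_ite_visit_eq_sum_transitionCount]
  have hv0 : visitCount (fun s => τ s ω) t n y ≠ 0 := by rwa [hv]
  have h1 : ∀ x, (transitionCount (fun s => τ s ω) t n y x : ℝ) =
      m * empiricalKernel (fun s => τ s ω) t n y x := fun x => by
    rw [← mul_empiricalKernel _ t n y x hv0, hv]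
  have hsum : ∑ x, (transitionCount (fun s => τ s ω) t n y x : ℝ) * F x =
      m * (4 * ε * (∑ x ∈ S, empiricalKernel (fun s => τ s ω) t n y x - ∑ x ∈ S, p n y x) -
        2 * ε ^ 2) := by
    have h2 := (isKernel_empiricalKernel (fun s => τ s ω) t n y).2
    have h3 : ∑ x, empiricalKernel (fun s => τ s ω) t n y x * (if x ∈ S then (1 : ℝ) else 0) =
        ∑ x ∈ S, empiricalKernel (fun s => τ s ω) t n y x := by
      simp
    calc ∑ x, (transitionCount (fun s => τ s ω) t n y x : ℝ) * F x
        = ∑ x, (m * (4 * ε) * (empiricalKernel (fun s => τ s ω) t n y x *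
            (if x ∈ S then (1 : ℝ) else 0)) - m * (4 * ε * (∑ z ∈ S, p n y z) + 2 * ε ^ 2) *
            empiricalKernel (fun s => τ s ω) t n y x) := by
          refine Finset.sum_congr rfl fun x _ => ?_
          rw [h1 x]
          simp only [hF]
          ring
      _ = _ := by
          rw [Finset.sum_sub_distrib, ← Finset.mul_sum, ← Finset.mul_sum, h2, h3]
          ring
  rw [hsum]
  have h4 : (0 : ℝ) ≤ m := Nat.cast_nonneg m
  -- A deviation of at least `ε` makes the sum at least `m * (4 * ε ^ 2 - 2 * ε ^ 2)`, the required
  -- level.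
  have h5 := mul_le_mul_of_nonneg_left hge (mul_nonneg h4 (by linarith : 0 ≤ 4 * ε))
  nlinarith

lemma IsRestartProtocol.measureReal_mean_error_ge_le (h : IsRestartProtocol ℙ 𝓖 T p ρ π τ)
    (hp : IsKernel p) (hρ : ρ ∈ stdSimplex ℝ (X × A)) (hT : 0 < T) (n : Fin N) {ε : ℝ}
    (hε : 0 ≤ ε) :
    ℙ.real {ω | ε ≤ ∑ t ∈ Finset.range T, ((∑ y, trajectoryWeight p ρ π τ t ω y *
        l1norm (p n (y n.castSucc) - empiricalKernel (fun s => τ s ω) t n (y n.castSucc))) -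
        l1norm (p n (τ t ω n.castSucc) -
          empiricalKernel (fun s => τ s ω) t n (τ t ω n.castSucc)))} ≤
      Real.exp (-(ε ^ 2 / (2 * T))) :=
  h.hasCondWeights.measureReal_sum_sub_ge_le hT
    (fun _ ht ω => h.trajectoryWeight_mem_stdSimplex hp hρ ht ω)
    (fun _ ht y => h.measurable_trajectoryWeight ht y)
    (D := fun t y ω =>
      l1norm (p n (y n.castSucc) - empiricalKernel (fun s => τ s ω) t n (y n.castSucc)))
    (fun t _ _ _ => ⟨l1norm_nonneg _, l1norm_sub_le_two (hp n _) (isKernel_empiricalKernel _ t n _)⟩)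
    (fun t ht y => measurable_l1norm_sub_empiricalKernel (m := 𝓖 t) (h.measurableSet_of_lt ht.le)
      (p n (y n.castSucc)) n (y n.castSucc))
    hε

end Concentration

end PeriodicMDP

/-! ### Union bounds and degenerate cases -/

namespace PeriodicMDP

variable {X A : Type*} [Fintype X] [Fintype A] [DecidableEq X] [DecidableEq A] {N : ℕ}

/-- The `L₁` distance is twice the excess mass of one set, so one-sided bounds over all sets
suffice; this costs a union over `2 ^ |X|` sets. -/
lemma l1norm_sub_le_of_forall_finset {ι : Type*} [Fintype ι] {v w : ι → ℝ}
    (hv : v ∈ stdSimplex ℝ ι) (hw : w ∈ stdSimplex ℝ ι) {ε : ℝ}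
    (h : ∀ S : Finset ι, ∑ i ∈ S, w i - ∑ i ∈ S, v i ≤ ε / 2) : l1norm (v - w) ≤ ε := by
  obtain ⟨S, hS⟩ := exists_l1norm_sub_eq hw hv
  have hsymm : l1norm (v - w) = l1norm (w - v) :=
    Finset.sum_congr rfl fun i _ => abs_sub_comm _ _
  rw [hsymm, hS]
  linarith [h S]

/-- Absorbs the number of sets of states into the failure probability `K⁻¹ ^ |X|`, leaving one
factor `K` to produce `δ`. This is where two states and `4 ≤ K` are needed. -/
lemma two_pow_le_pow_pred {K : ℝ} (hK : 4 ≤ K) {k : ℕ} (hk : 2 ≤ k) :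
    (2 : ℝ) ^ k ≤ K ^ (k - 1) := by
  calc (2 : ℝ) ^ k ≤ 2 ^ (2 * (k - 1)) := pow_le_pow_right₀ (by norm_num) (by omega)
    _ = 4 ^ (k - 1) := by rw [pow_mul]; norm_num
    _ ≤ K ^ (k - 1) := pow_le_pow_left₀ (by norm_num) hK _

/-- On the event that all empirical rows satisfy the `L₁` confidence bound, the errors at the
visited pairs sum up to at most a multiple of `√T`. -/
lemma sum_l1norm_visited_le {p : Fin N → X × A → X → ℝ} (hp : IsKernel p)
    (τ : ℕ → Fin (N + 1) → X × A) {T : ℕ} {c : ℝ} (hc : 2 / 3 ≤ c) (n : Fin N)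
    (h : ∀ t < T, ∀ y, visitCount τ t n y ≠ 0 → ∀ S : Finset X,
      ∑ x ∈ S, empiricalKernel τ t n y x - ∑ x ∈ S, p n y x ≤
        c / √(visitCount τ t n y : ℝ) / 2) :
    ∑ t ∈ Finset.range T,
        l1norm (p n (τ t n.castSucc) - empiricalKernel τ t n (τ t n.castSucc)) ≤
      3 * c * √((Fintype.card X : ℝ) * Fintype.card A * T) := by
  refine le_trans (Finset.sum_le_sum fun t ht => ?_) ((sum_width_le τ hc T n).trans
    (mul_le_mul_of_nonneg_left (sum_sqrt_visitCount_le τ T n) (by linarith)))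
  have hker := isKernel_empiricalKernel τ t n (τ t n.castSucc)
  split_ifs with h0
  · exact l1norm_sub_le_two (hp n _) hker
  · exact l1norm_sub_le_of_forall_finset (hp n _) hker (h t (Finset.mem_range.1 ht) _ h0)

section Union

variable {Ω : Type*} {mΩ : MeasurableSpace Ω} {ℙ : Measure Ω} [IsProbabilityMeasure ℙ]
  {𝓖 : Filtration ℕ mΩ} {T : ℕ} {p : Fin N → X × A → X → ℝ} {ρ : X × A → ℝ}
  {π : ℕ → Ω → Fin N → X → A → ℝ} {τ : ℕ → Ω → Fin (N + 1) → X × A}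

/-- Uniform `L₁` confidence bounds for the rows of the empirical kernels. -/
lemma IsRestartProtocol.measureReal_confidence_failure_le (h : IsRestartProtocol ℙ 𝓖 T p ρ π τ)
    (hp : IsKernel p) (hρ : ρ ∈ stdSimplex ℝ (X × A)) (hX : 2 ≤ Fintype.card X)
    {δ K : ℝ} (hK : 4 ≤ K) (hKδ : (Fintype.card X : ℝ) * Fintype.card A * N * T = K * δ)
    (hδ : 0 ≤ δ) :
    ℙ.real {ω | ∃ n : Fin N, ∃ y : X × A, ∃ S : Finset X, ∃ t < T,
      visitCount (fun s => τ s ω) t n y ≠ 0 ∧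
        √(2 * Fintype.card X * Real.log K) / √(visitCount (fun s => τ s ω) t n y : ℝ) / 2 <
          ∑ x ∈ S, empiricalKernel (fun s => τ s ω) t n y x - ∑ x ∈ S, p n y x} ≤ δ := by
  have hK0 : 0 < K := by linarith
  have hlog : 0 ≤ Real.log K := Real.log_nonneg (by linarith)
  set c := √(2 * Fintype.card X * Real.log K) with hc
  -- The third index is the number of visits minus one: zero visits are excluded, and fewer than `T`
  -- visits occur before an episode `t < T`.
  set B : Fin N × (X × A) × Fin T × Finset X → Set Ω := fun i =>
    {ω | ∃ t < T, visitCount (fun s => τ s ω) t i.1 i.2.1 = (i.2.2.1 : ℕ) + 1 ∧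
      c / √(((i.2.2.1 : ℕ) + 1 : ℕ) : ℝ) / 2 ≤
        ∑ x ∈ i.2.2.2, empiricalKernel (fun s => τ s ω) t i.1 i.2.1 x -
          ∑ x ∈ i.2.2.2, p i.1 i.2.1 x} with hB
  have hBle : ∀ i, ℙ.real (B i) ≤ (K ^ Fintype.card X)⁻¹ := fun i => by
    refine (h.measureReal_empirical_ge_le hp hρ i.1 i.2.1 (Nat.succ_ne_zero _) i.2.2.2
      (by positivity)).trans (le_of_eq ?_)
    have hm : (0 : ℝ) < ((i.2.2.1 : ℕ) + 1 : ℕ) := by positivity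
    -- The width is chosen so that the number of visits cancels and each bad event has probability
    -- at most `K⁻¹ ^ |X|`.
    have hexp : 2 * (((i.2.2.1 : ℕ) + 1 : ℕ) : ℝ) * (c / √(((i.2.2.1 : ℕ) + 1 : ℕ) : ℝ) / 2) ^ 2 =
        Fintype.card X * Real.log K := by
      rw [div_pow, div_pow, Real.sq_sqrt hm.le, hc, Real.sq_sqrt (by positivity)]
      field_simp
    rw [hexp, Real.exp_neg, mul_comm, Real.exp_mul, Real.exp_log hK0, Real.rpow_natCast]
  refine (measureReal_mono (s₂ := ⋃ i, B i) ?_).trans ((measureReal_iUnion_fintype_le B).trans ?_)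
  · rintro ω ⟨n, y, S, t, ht, hv, hlt⟩
    have hle := visitCount_le (fun s => τ s ω) t n y
    obtain ⟨m, hm⟩ := Nat.exists_eq_succ_of_ne_zero hv
    rw [Nat.succ_eq_add_one] at hm
    refine Set.mem_iUnion.2 ⟨(n, y, ⟨m, by omega⟩, S), t, ht, hm, ?_⟩
    rw [hm] at hlt
    exact hlt.le
  · refine (Finset.sum_le_sum fun i _ => hBle i).trans ?_
    rw [Finset.sum_const, Finset.card_univ, nsmul_eq_mul]
    simp only [Fintype.card_prod, Fintype.card_fin, Fintype.card_finset]
    push_cast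
    have hpow := two_pow_le_pow_pred hK hX
    have hsucc : K ^ Fintype.card X = K ^ (Fintype.card X - 1) * K := by
      rw [← pow_succ]
      congr 1
      omega
    rw [← div_eq_mul_inv, div_le_iff₀ (by positivity), hsucc]
    calc (N : ℝ) * (Fintype.card X * Fintype.card A * (T * 2 ^ Fintype.card X))
        = (Fintype.card X : ℝ) * Fintype.card A * N * T * 2 ^ Fintype.card X := by ring
      _ ≤ K * δ * K ^ (Fintype.card X - 1) := by
          rw [hKδ]
          exact mul_le_mul_of_nonneg_left hpow (by positivity)
      _ = _ := by ring

lemma IsRestartProtocol.measureReal_exists_mean_error_gt_le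
    (h : IsRestartProtocol ℙ 𝓖 T p ρ π τ) (hp : IsKernel p) (hρ : ρ ∈ stdSimplex ℝ (X × A))
    (hT : 0 < T) (hN : 0 < N) {δ : ℝ} (hδ0 : 0 < δ) (hδ1 : δ < 1) :
    ℙ.real {ω | ∃ n : Fin N, √(2 * T * Real.log (N / δ)) <
      ∑ t ∈ Finset.range T, ((∑ y, trajectoryWeight p ρ π τ t ω y *
        l1norm (p n (y n.castSucc) - empiricalKernel (fun s => τ s ω) t n (y n.castSucc))) -
        l1norm (p n (τ t ω n.castSucc) -
          empiricalKernel (fun s => τ s ω) t n (τ t ω n.castSucc)))} ≤ δ := by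
  have hN' : (1 : ℝ) ≤ N := Nat.one_le_cast.2 hN
  have hT' : (0 : ℝ) < T := Nat.cast_pos.2 hT
  have hlog : 0 ≤ Real.log (N / δ) := Real.log_nonneg ((one_le_div hδ0).2 (by linarith))
  refine (measureReal_mono (s₂ := ⋃ n : Fin N, _) ?_).trans
    ((measureReal_iUnion_fintype_le _).trans ((Finset.sum_le_sum fun n _ =>
      h.measureReal_mean_error_ge_le hp hρ hT n
        (Real.sqrt_nonneg (2 * T * Real.log (N / δ)))).trans ?_))
  · rintro ω ⟨n, hn⟩
    exact Set.mem_iUnion.2 ⟨n, hn.le⟩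
  · rw [Real.sq_sqrt (by positivity), mul_div_cancel_left₀ _ (by positivity), Real.exp_neg,
      Real.exp_log (by positivity), Finset.sum_const, Finset.card_univ, Fintype.card_fin,
      nsmul_eq_mul, inv_div, mul_div_cancel₀ _ (by linarith)]

end Union

/-- Only monotonicity and subadditivity enter, so none of the three sets has to be measurable. -/
lemma one_sub_two_mul_le_measureReal {Ω : Type*} {mΩ : MeasurableSpace Ω} {ℙ : Measure Ω}
    [IsProbabilityMeasure ℙ] {G B₁ B₂ : Set Ω} {δ : ℝ} (h₁ : ℙ.real B₁ ≤ δ) (h₂ : ℙ.real B₂ ≤ δ)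
    (h : ∀ ω, ω ∉ B₁ → ω ∉ B₂ → ω ∈ G) : 1 - 2 * δ ≤ ℙ.real G := by
  have hle : ℙ.real Set.univ ≤ ℙ.real G + (ℙ.real B₁ + ℙ.real B₂) := by
    refine le_trans (measureReal_mono (s₂ := G ∪ (B₁ ∪ B₂)) fun ω _ => ?_)
      ((measureReal_union_le _ _).trans (add_le_add le_rfl (measureReal_union_le _ _)))
    by_contra hω
    rw [Set.mem_union, Set.mem_union, not_or, not_or] at hω
    exact hω.1 (h ω hω.2.1 hω.2.2)
  rw [probReal_univ] at hle
  linarith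

omit [DecidableEq X] [DecidableEq A] in
lemma l1norm_sub_eq_zero_of_card_le_one (hX : Fintype.card X ≤ 1) {v w : X → ℝ}
    (hv : v ∈ stdSimplex ℝ X) (hw : w ∈ stdSimplex ℝ X) : l1norm (v - w) = 0 := by
  have := Fintype.card_le_one_iff_subsingleton.1 hX
  refine Finset.sum_eq_zero fun i _ => ?_
  have h1 := hv.2
  have h2 := hw.2
  rw [Fintype.sum_subsingleton _ i] at h1 h2
  rw [Pi.sub_apply, h1, h2, sub_self, abs_zero]

/-- If there are no steps, at most one episode or at most one state, then the initial
distributions are known exactly. -/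
lemma sum_l1norm_trueInit_sub_estInit_le_zero {p : Fin N → X × A → X → ℝ} (hp : IsKernel p)
    {ρ : X × A → ℝ} (hρ : ρ ∈ stdSimplex ℝ (X × A)) {α : ℝ} (hα1 : α < 1)
    (hα : AllPolicyContraction p α) {π : ℕ → Fin N → X → A → ℝ} (τ : ℕ → Fin (N + 1) → X × A)
    {T : ℕ} (hπ : ∀ t < T, IsPolicy (π t)) (htriv : N = 0 ∨ T ≤ 1 ∨ Fintype.card X ≤ 1) :
    ∑ t ∈ Finset.range T, l1norm (trueInit p ρ π t - estInit ρ π τ t) ≤ 0 := by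
  rcases htriv with rfl | hT | hX
  · simpa using sum_l1norm_trueInit_sub_estInit_le hp hρ hα1 hα τ hπ
  · refine le_of_eq (Finset.sum_eq_zero fun t ht => ?_)
    obtain rfl : t = 0 := by have := Finset.mem_range.1 ht; omega
    simp [trueInit, estInit, l1norm]
  · refine (sum_l1norm_trueInit_sub_estInit_le hp hρ hα1 hα τ hπ).trans (le_of_eq ?_)
    simp_rw [l1norm_sub_eq_zero_of_card_le_one hX (hp _ _) (isKernel_empiricalKernel τ _ _ _)]
    simp

end PeriodicMDP

/-! ### The main bound -/

open PeriodicMDP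

theorem mainTheorem3 {X A : Type*} [Fintype X] [Fintype A] [DecidableEq X] [DecidableEq A]
    {Ω : Type*} {mΩ : MeasurableSpace Ω} (ℙ : Measure Ω) [IsProbabilityMeasure ℙ]
    (𝓖 : Filtration ℕ mΩ) (N T : ℕ)
    (p : Fin N → X × A → X → ℝ) (hp : PeriodicMDP.IsKernel p)
    (ρ : X × A → ℝ) (hρ : ρ ∈ stdSimplex ℝ (X × A))
    (α : ℝ) (hα0 : 0 ≤ α) (hα1 : α < 1) (hα : PeriodicMDP.AllPolicyContraction p α)
    (π : ℕ → Ω → Fin N → X → A → ℝ) (τ : ℕ → Ω → Fin (N + 1) → X × A)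
    (h : PeriodicMDP.IsRestartProtocol ℙ 𝓖 T p ρ π τ)
    (δ : ℝ) (hδ0 : 0 < δ) (hδ1 : δ < 1) :
    1 - 2 * δ ≤ ℙ.real {ω |
      ∑ t ∈ Finset.range T,
        PeriodicMDP.l1norm (PeriodicMDP.trueInit p ρ (fun s => π s ω) t -
          PeriodicMDP.estInit ρ (fun s => π s ω) (fun s => τ s ω) t)
      ≤ (1 - α)⁻¹ *
        (3 * N * Fintype.card X *
            √(2 * Fintype.card A * T *
              Real.log (Fintype.card X * Fintype.card A * N * T / δ)) +
          2 * N * Fintype.card X * √(2 * T * Real.log (N / δ)))} := by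
  have hinv : 0 ≤ (1 - α)⁻¹ := inv_nonneg.2 (by linarith)
  -- In these cases the error vanishes surely; outside them `|X| ≥ 2` and `T ≥ 2`, which give `4 ≤
  -- K`.
  by_cases htriv : N = 0 ∨ T ≤ 1 ∨ Fintype.card X ≤ 1
  · refine le_trans (by linarith) (le_of_eq (probReal_univ (μ := ℙ)).symm) |>.trans
      (measureReal_mono fun ω _ => ?_)
    exact (sum_l1norm_trueInit_sub_estInit_le_zero hp hρ hα1 hα (fun s => τ s ω)
      (π := fun s => π s ω) (fun t ht => h.isPolicy t ht ω) htriv).trans (by positivity)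
  push Not at htriv
  obtain ⟨hN, hT, hX⟩ := htriv
  obtain ⟨y₀⟩ : Nonempty (X × A) := by
    by_contra hne
    rw [not_nonempty_iff] at hne
    have := hρ.2
    simp at this
  have hA : 1 ≤ Fintype.card A := Fintype.card_pos_iff.2 ⟨y₀.2⟩
  have hN1 : (1 : ℝ) ≤ N := Nat.one_le_cast.2 (Nat.one_le_iff_ne_zero.2 hN)
  have hT2 : (2 : ℝ) ≤ T := by exact_mod_cast hT
  have hX2 : (2 : ℝ) ≤ Fintype.card X := by exact_mod_cast hX
  have hA1 : (1 : ℝ) ≤ Fintype.card A := Nat.one_le_cast.2 hA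
  set K : ℝ := Fintype.card X * Fintype.card A * N * T / δ with hK
  have hKδ : (Fintype.card X : ℝ) * Fintype.card A * N * T = K * δ :=
    (div_mul_cancel₀ _ hδ0.ne').symm
  have hK4 : 4 ≤ K := by
    rw [hK, le_div_iff₀ hδ0]
    calc 4 * δ ≤ 2 * 1 * 1 * 2 := by linarith
      _ ≤ _ := by gcongr
  -- From `log K ≥ 1 - 1 / K`; then `c ^ 2 ≥ 3`, more than the pigeonhole bound asks for.
  have hlog : 3 / 4 ≤ Real.log K := by
    have h1 := Real.one_sub_inv_le_log_of_pos (show 0 < K by linarith)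
    have h2 : K⁻¹ ≤ 4⁻¹ := inv_anti₀ (by norm_num) hK4
    linarith
  set c := √(2 * Fintype.card X * Real.log K) with hc
  have hc23 : 2 / 3 ≤ c := by
    refine Real.le_sqrt_of_sq_le ?_
    nlinarith
  set ε := √(2 * T * Real.log (N / δ)) with hε
  have hfail₁ := h.measureReal_exists_mean_error_gt_le hp hρ (by omega) (by omega) hδ0 hδ1
  have hfail₂ := h.measureReal_confidence_failure_le hp hρ hX hK4 hKδ hδ0.le
  rw [← hε] at hfail₁
  rw [← hc] at hfail₂
  refine one_sub_two_mul_le_measureReal hfail₁ hfail₂ fun ω h₁ h₂ => ?_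
  rw [Set.mem_ofPred_eq] at h₁ h₂ ⊢
  push Not at h₁ h₂
  refine (sum_l1norm_trueInit_sub_estInit_le hp hρ hα1 hα (fun s => τ s ω)
    (π := fun s => π s ω) fun t ht => h.isPolicy t ht ω).trans
    (mul_le_mul_of_nonneg_left ?_ hinv)
  -- One `√|X|` comes from the confidence width and one from Cauchy–Schwarz over the pairs.
  have hsqrt : c * √((Fintype.card X : ℝ) * Fintype.card A * T) =
      Fintype.card X * √(2 * Fintype.card A * T * Real.log K) := by
    rw [hc, ← Real.sqrt_mul (by positivity), ← Real.sqrt_sq (show (0 : ℝ) ≤ Fintype.card X by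
      positivity), ← Real.sqrt_mul (by positivity), Real.sqrt_sq (by positivity)]
    congr 1
    ring
  have hstep : ∀ n ∈ (Finset.univ : Finset (Fin N)), ∑ t ∈ Finset.range T,
      ∑ y, trajectoryWeight p ρ π τ t ω y *
        l1norm (p n (y n.castSucc) - empiricalKernel (fun s => τ s ω) t n (y n.castSucc)) ≤
      3 * (Fintype.card X * √(2 * Fintype.card A * T * Real.log K)) + ε := fun n _ => by
    have hmean := h₁ n
    rw [Finset.sum_sub_distrib] at hmean
    have hvis := sum_l1norm_visited_le hp (fun s => τ s ω) hc23 n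
      fun t ht y hy S => h₂ n y S t ht hy
    rw [mul_assoc, hsqrt] at hvis
    linarith
  refine (Finset.sum_le_sum hstep).trans ?_
  rw [Finset.sum_const, Finset.card_univ, Fintype.card_fin, nsmul_eq_mul]
  -- The argument yields `N * ε`; the stated factor `2 * |X|` is slack.
  have hNε : N * ε ≤ 2 * N * Fintype.card X * ε := by
    refine mul_le_mul_of_nonneg_right ?_ (Real.sqrt_nonneg _)
    nlinarith
  linarith
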